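/- For a Lebesgue measurable set $F\subset\mathbb R^n$ let $$\operatorname{Per}(F)=\sup\Big\{\int_F \operatorname{div}\varphi\,dx:\ \varphi\in C^1_c(\mathbb R^n;\mathbb R^n),\ |\varphi|\le 1\Big\}\in[0,\infty].$$ A set $E\subset\mathbb R^n$ is a *minimizing hull* if $|\partial E|=0$ and $\operatorname{Per}(E)\le\operatorname{Per}(F)$ for every measurable $F\supset E$ such that $F\setminus E$ is relatively compact. Let $E\subset\mathbb R^n$ be a minimizing hull of finite perimeter and let $\Omega\subset E$ (the obstacle). For $h>0$, let $T_h(E)$ denote the maximal minimizer of $$F\longmapsto \operatorname{Per}(F)+\frac1h\int_{F\Delta E}\operatorname{dist}(x,\partial E)\,dx$$ among all measurable sets $F$ with $\Omega\subset F$ and $|F\setminus E|<\infty$ (the last condition is automatic for every $F$ of finite energy when $E$ is bounded); that is, $T_h(E)$ is a minimizer which contains every other minimizer up to a null set, and it is thereby determined up to a null set. Here $\operatorname{dist}(x,\emptyset)=\infty$. If $h>\tilde h>0$, then $T_h(E)\subset T_{\tilde h}(E)$ up to a null set, i.e. $|T_h(E)\setminus T_{\tilde h}(E)|=0$, for the maximal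 minimizers $T_h(E)$ and $T_{\tilde h}(E)$. -/

import Mathlib

open MeasureTheory

noncomputable section

namespace ObstacleFlow

/-- Divergence of a vector field on `ℝⁿ`, as the sum of its diagonal partial derivatives. -/
def divergence {n : ℕ} (φ : EuclideanSpace ℝ (Fin n) → EuclideanSpace ℝ (Fin n))
    (x : EuclideanSpace ℝ (Fin n)) : ℝ :=
  ∑ i, fderiv ℝ φ x (EuclideanSpace.single i 1) i

/-- De Giorgi perimeter of a (Lebesgue measurable) set: the supremum of `∫_E div φ` over
compactly supported `C¹` vector fields `φ` with `|φ| ≤ 1`. -/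
def perimeter {n : ℕ} (E : Set (EuclideanSpace ℝ (Fin n))) : ENNReal :=
  ⨆ (φ : EuclideanSpace ℝ (Fin n) → EuclideanSpace ℝ (Fin n)) (_ : ContDiff ℝ 1 φ)
    (_ : HasCompactSupport φ) (_ : ∀ x, ‖φ x‖ ≤ 1),
    ENNReal.ofReal (∫ x in E, divergence φ x)

/-- `E` is a minimizing hull: `|∂E| = 0` and `Per E ≤ Per F` for every measurable `F ⊇ E` such
that `F \ E` is relatively compact. (`|∂E| = 0` makes `E` Lebesgue measurable.) -/
structure IsMinimizingHull {n : ℕ} (E : Set (EuclideanSpace ℝ (Fin n))) : Prop where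
  frontier_null : volume (frontier E) = 0
  perimeter_le : ∀ F : Set (EuclideanSpace ℝ (Fin n)), NullMeasurableSet F volume →
    E ⊆ F → Bornology.IsBounded (F \ E) → perimeter E ≤ perimeter F

/-- The energy `Per F + (1/h) ∫_{F Δ E} dist(x, ∂E) dx`, where `dist(x, ∂E) = |d_E(x)|` is the
absolute value of the signed distance to `E` (equal to `∞` if `∂E = ∅`). -/
def energy {n : ℕ} (h : ℝ) (E F : Set (EuclideanSpace ℝ (Fin n))) : ENNReal :=
  perimeter F +
    ENNReal.ofReal (1 / h) * ∫⁻ x in symmDiff F E, Metric.infEDist x (frontier E)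

/-- Competitors: measurable sets containing the obstacle `Ω` and exceeding `E` by a set of finite
measure. For bounded `E` the last condition holds for every `F` of finite energy. -/
structure IsAdmissible {n : ℕ} (Ω E F : Set (EuclideanSpace ℝ (Fin n))) : Prop where
  measurable : NullMeasurableSet F volume
  obstacle_subset : Ω ⊆ F
  finite_excess : volume (F \ E) < ⊤

/-- `F` is a minimizer of the energy among the competitors. -/
structure IsStepMinimizer {n : ℕ} (h : ℝ) (Ω E F : Set (EuclideanSpace ℝ (Fin n))) : Prop where
  admissible : IsAdmissible Ω E F
  energy_le : ∀ G : Set (EuclideanSpace ℝ (Fin n)), IsAdmissible Ω E G →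
    energy h E F ≤ energy h E G

/-- `F = T_h(E)`: `F` is the maximal minimizer, that is, a minimizer which contains every other
minimizer up to a null set. This determines `F` up to a null set. -/
structure IsStep {n : ℕ} (h : ℝ) (Ω E F : Set (EuclideanSpace ℝ (Fin n))) : Prop where
  minimizer : IsStepMinimizer h Ω E F
  maximal : ∀ G : Set (EuclideanSpace ℝ (Fin n)), IsStepMinimizer h Ω E G →
    volume (G \ F) = 0

end ObstacleFlow

end

/-!
The perimeter is submodular, `Per (A ∩ B) + Per (A ∪ B) ≤ Per A + Per B`. To see this, mollify the
indicators to functions `u, v` with values in `[0, 1]`; given test fields `φ, ψ` for the left-hand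
side, test `u` with `v φ + (1 - v) ψ` and `v` with `u φ + (1 - u) ψ`. The terms containing `∇u` and
`∇v` add up to a divergence, and `u v` and `u + v - u v` tend to the indicators of `A ∩ B` and
`A ∪ B`.

A minimizing hull `E` also satisfies `Per E ≤ Per G` if `G \ E` merely has finite measure: replace
`G` by `E` outside a large ball. By finiteness of `|G \ E|`, some radius has a cut of small area,
and `E` has little perimeter outside a large ball. Together with submodularity this shows that
minimizers do not leave `E`, since `F ∩ E` has no more energy than `F`.

Let `F`, `F'` be minimizers for `h > h'` and let `I` be the integral of `dist(·, ∂E)` over `F \ F'`.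
As both sets lie in `E`, comparing `F` with `F ∩ F'` and `F'` with `F ∪ F'` gives
`Per F ≤ Per (F ∩ F') + I / h` and `Per F' + I / h' ≤ Per (F ∪ F')`. By submodularity
`I / h' ≤ I / h`, so `I = 0`, and `F \ F'` is null because `|∂E| = 0`.
-/

open Filter Topology ContinuousLinearMap Convolution
open scoped NNReal

noncomputable section

namespace ObstacleFlow

variable {n : ℕ} {φ ψ : EuclideanSpace ℝ (Fin n) → EuclideanSpace ℝ (Fin n)}
  {u v χ : EuclideanSpace ℝ (Fin n) → ℝ} {x : EuclideanSpace ℝ (Fin n)}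
  {A B E F G Ω : Set (EuclideanSpace ℝ (Fin n))}

section Divergence

lemma divergence_zero :
    divergence (0 : EuclideanSpace ℝ (Fin n) → EuclideanSpace ℝ (Fin n)) = 0 := by
  ext x
  simp [divergence]

lemma divergence_add (hφ : DifferentiableAt ℝ φ x) (hψ : DifferentiableAt ℝ ψ x) :
    divergence (φ + ψ) x = divergence φ x + divergence ψ x := by
  simp [divergence, fderiv_add hφ hψ, Finset.sum_add_distrib]

lemma divergence_sub (hφ : DifferentiableAt ℝ φ x) (hψ : DifferentiableAt ℝ ψ x) :
    divergence (φ - ψ) x = divergence φ x - divergence ψ x := by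
  simp [divergence, fderiv_sub hφ hψ, Finset.sum_sub_distrib]

lemma divergence_smul (hχ : DifferentiableAt ℝ χ x) (hφ : DifferentiableAt ℝ φ x) :
    divergence (χ • φ) x = χ x * divergence φ x + fderiv ℝ χ x (φ x) := by
  have hcoord : fderiv ℝ χ x (φ x) = ∑ i, φ x i * fderiv ℝ χ x (EuclideanSpace.single i 1) := by
    conv_lhs => rw [← (EuclideanSpace.basisFun (Fin n) ℝ).sum_repr (φ x), map_sum]
    simp
  rw [hcoord, divergence, fderiv_smul hχ hφ]
  simp [divergence, Finset.sum_add_distrib, Finset.mul_sum, mul_comm]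

lemma divergence_comp_add_right (φ : EuclideanSpace ℝ (Fin n) → EuclideanSpace ℝ (Fin n))
    (t x : EuclideanSpace ℝ (Fin n)) :
    divergence (fun y => φ (y + t)) x = divergence φ (x + t) := by
  simp [divergence, fderiv_comp_add_right]

lemma continuous_divergence (hφ : ContDiff ℝ 1 φ) : Continuous (divergence φ) := by
  have := hφ.continuous_fderiv one_ne_zero
  unfold divergence
  fun_prop

lemma hasCompactSupport_divergence (hφ : HasCompactSupport φ) :
    HasCompactSupport (divergence φ) := by
  refine (hφ.fderiv (𝕜 := ℝ)).mono fun x hx => ?_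
  contrapose! hx
  simp only [Function.mem_support, not_not] at hx ⊢
  simp [divergence, hx]

lemma integrable_mul_divergence (hu : LocallyIntegrable u) (hφ : ContDiff ℝ 1 φ)
    (hφc : HasCompactSupport φ) : Integrable fun x => u x * divergence φ x :=
  hu.integrable_smul_right_of_hasCompactSupport (continuous_divergence hφ)
    (hasCompactSupport_divergence hφc)

lemma integral_fderiv_apply_eq_zero {V W : Type*} [NormedAddCommGroup V] [NormedSpace ℝ V]
    [FiniteDimensional ℝ V] [MeasurableSpace V] [BorelSpace V] [NormedAddCommGroup W]
    [NormedSpace ℝ W] {μ : Measure V} [μ.IsAddHaarMeasure] {f : V → W} (hf : ContDiff ℝ 1 f)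
    (hfc : HasCompactSupport f) (v : V) : ∫ x, fderiv ℝ f x v ∂μ = 0 := by
  have hderiv : Integrable (fun x => fderiv ℝ f x v) μ :=
    ((hf.continuous_fderiv one_ne_zero).clm_apply
      continuous_const).integrable_of_hasCompactSupport (hfc.fderiv_apply ℝ v)
  simpa using integral_smul_fderiv_eq_neg_fderiv_smul_of_integrable (μ := μ) (𝕜 := ℝ)
    (f := fun _ => (1 : ℝ)) (g := f) (v := v) (by simp) (by simpa using hderiv)
    (by simpa using hf.continuous.integrable_of_hasCompactSupport hfc)
    (fun _ _ => by fun_prop) (fun x _ => hf.differentiable one_ne_zero x)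

lemma integral_divergence (hφ : ContDiff ℝ 1 φ) (hφc : HasCompactSupport φ) :
    ∫ x, divergence φ x = 0 := by
  have hcoord (i : Fin n) : ContDiff ℝ 1 fun x => φ x i := by fun_prop
  have hcoordc (i : Fin n) : HasCompactSupport fun x => φ x i :=
    hφc.comp_left (g := fun y : EuclideanSpace ℝ (Fin n) => y i) rfl
  have hdiv (x : EuclideanSpace ℝ (Fin n)) : divergence φ x =
      ∑ i, fderiv ℝ (fun y => φ y i) x (EuclideanSpace.single i 1) := by
    refine Finset.sum_congr rfl fun i _ => ?_
    have hproj := ((EuclideanSpace.proj (𝕜 := ℝ) i).hasFDerivAt.comp x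
      (hφ.differentiable one_ne_zero x).hasFDerivAt).fderiv
    exact (DFunLike.congr_fun hproj (EuclideanSpace.single i 1)).symm
  simp_rw [hdiv]
  rw [integral_finsetSum _ fun i _ => ((((hcoord i).continuous_fderiv one_ne_zero).clm_apply
    continuous_const).integrable_of_hasCompactSupport ((hcoordc i).fderiv_apply ℝ _))]
  exact Finset.sum_eq_zero fun i _ => integral_fderiv_apply_eq_zero (hcoord i) (hcoordc i) _

end Divergence

section TestFields

/-- The vector fields tested against in the definition of the perimeter. -/
structure IsTestField (φ : EuclideanSpace ℝ (Fin n) → EuclideanSpace ℝ (Fin n)) : Prop where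
  contDiff : ContDiff ℝ 1 φ
  hasCompactSupport : HasCompactSupport φ
  norm_le_one : ∀ x, ‖φ x‖ ≤ 1

namespace IsTestField

lemma zero : IsTestField (0 : EuclideanSpace ℝ (Fin n) → EuclideanSpace ℝ (Fin n)) :=
  ⟨contDiff_const, .zero, by simp⟩

lemma differentiable (hφ : IsTestField φ) : Differentiable ℝ φ :=
  hφ.contDiff.differentiable one_ne_zero

lemma integrable_mul_divergence (hφ : IsTestField φ) (hu : LocallyIntegrable u) :
    Integrable fun x => u x * divergence φ x :=
  ObstacleFlow.integrable_mul_divergence hu hφ.contDiff hφ.hasCompactSupport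

lemma integrable_divergence (hφ : IsTestField φ) : Integrable (divergence φ) :=
  (continuous_divergence hφ.contDiff).integrable_of_hasCompactSupport
    (hasCompactSupport_divergence hφ.hasCompactSupport)

lemma comp_add_right (hφ : IsTestField φ) (t : EuclideanSpace ℝ (Fin n)) :
    IsTestField fun x => φ (x + t) where
  contDiff := hφ.contDiff.comp (contDiff_id.add contDiff_const)
  hasCompactSupport := hφ.hasCompactSupport.comp_homeomorph (Homeomorph.addRight t)
  norm_le_one _ := hφ.norm_le_one _

lemma smul_add_one_sub_smul (hφ : IsTestField φ) (hψ : IsTestField ψ) (hχ : ContDiff ℝ 1 χ)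
    (hχI : ∀ x, χ x ∈ Set.Icc (0 : ℝ) 1) : IsTestField (χ • φ + (1 - χ) • ψ) where
  contDiff := (hχ.smul hφ.contDiff).add ((contDiff_const.sub hχ).smul hψ.contDiff)
  hasCompactSupport := hφ.hasCompactSupport.smul_left.add hψ.hasCompactSupport.smul_left
  norm_le_one x := mem_closedBall_zero_iff.1 <| convex_closedBall 0 1
    (mem_closedBall_zero_iff.2 (hφ.norm_le_one x)) (mem_closedBall_zero_iff.2 (hψ.norm_le_one x))
    (hχI x).1 (sub_nonneg.2 (hχI x).2) (add_sub_cancel _ _)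

lemma smul (hφ : IsTestField φ) (hχ : ContDiff ℝ 1 χ) (hχI : ∀ x, χ x ∈ Set.Icc (0 : ℝ) 1) :
    IsTestField (χ • φ) := by
  simpa using hφ.smul_add_one_sub_smul zero hχ hχI

lemma add_of_forall_eq_zero_or (hφ : IsTestField φ) (hψ : IsTestField ψ)
    (h : ∀ x, φ x = 0 ∨ ψ x = 0) : IsTestField (φ + ψ) where
  contDiff := hφ.contDiff.add hψ.contDiff
  hasCompactSupport := hφ.hasCompactSupport.add hψ.hasCompactSupport
  norm_le_one x := by
    rcases h x with h0 | h0
    · simpa [h0] using hψ.norm_le_one x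
    · simpa [h0] using hφ.norm_le_one x

end IsTestField

end TestFields

section Variation

/-- The variation `|Du|(ℝⁿ)` of a locally integrable function, as the supremum of `∫ u div φ`
over all test fields. -/
def variation (u : EuclideanSpace ℝ (Fin n) → ℝ) : ENNReal :=
  ⨆ (φ) (_ : IsTestField φ), ENNReal.ofReal (∫ x, u x * divergence φ x)

lemma IsTestField.ofReal_integral_le_variation (hφ : IsTestField φ)
    (u : EuclideanSpace ℝ (Fin n) → ℝ) :
    ENNReal.ofReal (∫ x, u x * divergence φ x) ≤ variation u :=
  le_iSup₂_of_le φ hφ le_rfl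

lemma IsTestField.integral_le_toReal_variation (hφ : IsTestField φ) (hvar : variation u ≠ ⊤) :
    ∫ x, u x * divergence φ x ≤ (variation u).toReal :=
  (ENNReal.ofReal_le_iff_le_toReal hvar).1 (hφ.ofReal_integral_le_variation u)

lemma variation_indicator (hA : NullMeasurableSet A) :
    variation (A.indicator 1) = perimeter A := by
  have hint (φ : EuclideanSpace ℝ (Fin n) → EuclideanSpace ℝ (Fin n)) :
      ∫ x, A.indicator 1 x * divergence φ x = ∫ x in A, divergence φ x := by
    rw [← integral_indicator₀ hA]
    congr 1 with x
    by_cases hx : x ∈ A <;> simp [hx]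
  simp only [variation, perimeter, hint]
  refine iSup_congr fun φ => le_antisymm (iSup_le fun hφ => ?_) (iSup_le fun h₁ =>
    iSup₂_le fun h₂ h₃ => le_iSup_of_le ⟨h₁, h₂, h₃⟩ le_rfl)
  exact le_iSup_of_le hφ.contDiff (le_iSup₂_of_le hφ.hasCompactSupport hφ.norm_le_one le_rfl)

lemma variation_add_variation_le {c : ENNReal}
    (h : ∀ φ ψ, IsTestField φ → IsTestField ψ →
      ENNReal.ofReal ((∫ x, u x * divergence φ x) + ∫ x, v x * divergence ψ x) ≤ c) :
    variation u + variation v ≤ c := by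
  refine ENNReal.biSup_add_biSup_le' ⟨0, .zero⟩ ⟨0, .zero⟩ fun φ hφ ψ hψ => ?_
  rcases le_total (∫ x, u x * divergence φ x) 0 with hu | hu
  · simpa [ENNReal.ofReal_of_nonpos hu, divergence_zero] using h 0 ψ .zero hψ
  rcases le_total (∫ x, v x * divergence ψ x) 0 with hv | hv
  · simpa [ENNReal.ofReal_of_nonpos hv, divergence_zero] using h φ 0 hφ .zero
  · exact (ENNReal.ofReal_add hu hv).symm.trans_le (h φ ψ hφ hψ)

lemma tendsto_integral_mul_divergence {ι : Type*} {l : Filter ι} [l.IsCountablyGenerated]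
    {w : ι → EuclideanSpace ℝ (Fin n) → ℝ} {C : ℝ} (hw : ∀ k, AEStronglyMeasurable (w k))
    (hC : ∀ k x, ‖w k x‖ ≤ C) (hlim : ∀ᵐ x, Tendsto (fun k => w k x) l (𝓝 (u x)))
    (hφ : IsTestField φ) :
    Tendsto (fun k => ∫ x, w k x * divergence φ x) l (𝓝 (∫ x, u x * divergence φ x)) := by
  have hdiv := hφ.integrable_divergence
  refine tendsto_integral_filter_of_dominated_convergence (fun x => C * ‖divergence φ x‖)
    (.of_forall fun k => (hw k).mul hdiv.aestronglyMeasurable)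
    (.of_forall fun k => .of_forall fun x => ?_) (hdiv.norm.const_mul C)
    (hlim.mono fun x hx => hx.mul_const _)
  rw [norm_mul]
  gcongr
  exact hC k x

lemma variation_le_liminf {ι : Type*} {l : Filter ι} [l.IsCountablyGenerated] [l.NeBot]
    {w : ι → EuclideanSpace ℝ (Fin n) → ℝ} {C : ℝ} (hw : ∀ k, AEStronglyMeasurable (w k))
    (hC : ∀ k x, ‖w k x‖ ≤ C) (hlim : ∀ᵐ x, Tendsto (fun k => w k x) l (𝓝 (u x))) :
    variation u ≤ liminf (fun k => variation (w k)) l := by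
  refine iSup₂_le fun φ hφ => ?_
  rw [← (ENNReal.tendsto_ofReal (tendsto_integral_mul_divergence hw hC hlim hφ)).liminf_eq]
  exact liminf_le_liminf (.of_forall fun k => hφ.ofReal_integral_le_variation (w k))

-- If a field supported away from a nearly optimal `φ` gained more than `ε`, adding it to `φ` would
-- beat the supremum.
lemma exists_isCompact_forall_integral_le (hu : LocallyIntegrable u) (hvar : variation u ≠ ⊤)
    {ε : ℝ} (hε : 0 < ε) :
    ∃ K, IsCompact K ∧ ∀ ψ, IsTestField ψ → (∀ x ∈ K, ψ x = 0) →
      ∫ x, u x * divergence ψ x ≤ ε := by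
  obtain ⟨φ, hφ, hlt⟩ : ∃ φ, IsTestField φ ∧
      (variation u).toReal < (∫ x, u x * divergence φ x) + ε := by
    by_contra! hle
    have hpos : 0 ≤ (variation u).toReal - ε := by simpa [divergence_zero] using hle 0 .zero
    have hbound : variation u ≤ ENNReal.ofReal ((variation u).toReal - ε) :=
      iSup₂_le fun φ hφ => ENNReal.ofReal_le_ofReal (le_sub_iff_add_le.2 (hle φ hφ))
    linarith [ENNReal.toReal_le_of_le_ofReal hpos hbound]
  refine ⟨tsupport φ, hφ.hasCompactSupport, fun ψ hψ hψ0 => ?_⟩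
  have hsum : IsTestField (φ + ψ) := hφ.add_of_forall_eq_zero_or hψ fun x =>
    or_iff_not_imp_left.2 fun hx => hψ0 x (subset_tsupport φ hx)
  have hadd : ∫ x, u x * divergence (φ + ψ) x =
      (∫ x, u x * divergence φ x) + ∫ x, u x * divergence ψ x := by
    rw [← integral_add (hφ.integrable_mul_divergence hu) (hψ.integrable_mul_divergence hu)]
    congr 1 with x
    rw [divergence_add (hφ.differentiable x) (hψ.differentiable x), mul_add]
  linarith [hsum.integral_le_toReal_variation hvar]

end Variation

section Mollification

/-- The mollification of a function by a normalized smooth bump centred at the origin. -/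
def mollify (ρ : ContDiffBump (0 : EuclideanSpace ℝ (Fin n)))
    (u : EuclideanSpace ℝ (Fin n) → ℝ) : EuclideanSpace ℝ (Fin n) → ℝ :=
  ρ.normed volume ⋆[lsmul ℝ ℝ, volume] u

lemma mollify_apply (ρ : ContDiffBump (0 : EuclideanSpace ℝ (Fin n)))
    (u : EuclideanSpace ℝ (Fin n) → ℝ) (x : EuclideanSpace ℝ (Fin n)) :
    mollify ρ u x = ∫ t, ρ.normed volume t * u (x - t) := rfl

lemma locallyIntegrable_of_norm_le {X V : Type*} [TopologicalSpace X] [MeasurableSpace X]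
    [NormedAddCommGroup V] {μ : Measure X} [IsLocallyFiniteMeasure μ] {f : X → V}
    (hf : AEStronglyMeasurable f μ) {C : ℝ} (hC : ∀ x, ‖f x‖ ≤ C) : LocallyIntegrable f μ :=
  (locallyIntegrable_const C).mono hf (.of_forall fun x => (hC x).trans (le_abs_self C))

lemma contDiff_mollify (ρ : ContDiffBump (0 : EuclideanSpace ℝ (Fin n)))
    (hu : LocallyIntegrable u) : ContDiff ℝ 1 (mollify ρ u) :=
  ρ.hasCompactSupport_normed.contDiff_convolution_left (n := 1) _ ρ.contDiff_normed hu

lemma mollify_mem_Icc (ρ : ContDiffBump (0 : EuclideanSpace ℝ (Fin n)))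
    (hu : ∀ x, u x ∈ Set.Icc (0 : ℝ) 1) (x : EuclideanSpace ℝ (Fin n)) :
    mollify ρ u x ∈ Set.Icc (0 : ℝ) 1 := by
  have hnonneg (t : EuclideanSpace ℝ (Fin n)) : 0 ≤ ρ.normed volume t * u (x - t) :=
    mul_nonneg (ρ.nonneg_normed t) (hu _).1
  refine ⟨integral_nonneg hnonneg, ?_⟩
  rw [mollify_apply, ← ρ.integral_normed (μ := volume)]
  exact integral_mono_of_nonneg (.of_forall hnonneg) ρ.integrable_normed
    (.of_forall fun t => mul_le_of_le_one_right (ρ.nonneg_normed t) (hu _).2)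

lemma integral_comp_sub_mul_divergence (u : EuclideanSpace ℝ (Fin n) → ℝ)
    (φ : EuclideanSpace ℝ (Fin n) → EuclideanSpace ℝ (Fin n)) (t : EuclideanSpace ℝ (Fin n)) :
    ∫ x, u (x - t) * divergence φ x = ∫ x, u x * divergence (fun y => φ (y + t)) x := by
  rw [← integral_add_right_eq_self _ t]
  simp only [add_sub_cancel_right, divergence_comp_add_right]

lemma integrable_normed_mul_mul_divergence (ρ : ContDiffBump (0 : EuclideanSpace ℝ (Fin n)))
    (hu : AEStronglyMeasurable u) {C : ℝ} (hC : ∀ x, ‖u x‖ ≤ C) (hφ : IsTestField φ) :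
    Integrable (fun p : EuclideanSpace ℝ (Fin n) × EuclideanSpace ℝ (Fin n) =>
      ρ.normed volume p.2 * u (p.1 - p.2) * divergence φ p.1) (volume.prod volume) := by
  have hdiv := hφ.integrable_divergence
  have hρ : Integrable (ρ.normed volume) := ρ.integrable_normed
  refine ((hdiv.mul_prod hρ).mul_bdd (c := C) (hu.comp_quasiMeasurePreserving
    (quasiMeasurePreserving_sub volume volume)) (.of_forall fun p => hC _)).congr
    (.of_forall fun p => ?_)
  simp only [Function.comp_apply]
  ring

lemma variation_mollify_le (ρ : ContDiffBump (0 : EuclideanSpace ℝ (Fin n)))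
    (hu : AEStronglyMeasurable u) {C : ℝ} (hC : ∀ x, ‖u x‖ ≤ C) :
    variation (mollify ρ u) ≤ variation u := by
  by_cases hvar : variation u = ⊤
  · simp [hvar]
  refine iSup₂_le fun φ hφ => ENNReal.ofReal_le_of_le_toReal ?_
  have hint := integrable_normed_mul_mul_divergence ρ hu hC hφ
  calc ∫ x, mollify ρ u x * divergence φ x
      = ∫ x, ∫ t, ρ.normed volume t * u (x - t) * divergence φ x := by
        simp only [mollify_apply, integral_mul_const]
    _ = ∫ t, ∫ x, ρ.normed volume t * u (x - t) * divergence φ x := integral_integral_swap hint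
    _ ≤ ∫ t, ρ.normed volume t * (variation u).toReal := by
        refine integral_mono hint.integral_prod_right (ρ.integrable_normed.mul_const _) fun t => ?_
        simp only [mul_assoc, integral_const_mul, integral_comp_sub_mul_divergence]
        exact mul_le_mul_of_nonneg_left
          ((hφ.comp_add_right t).integral_le_toReal_variation hvar) (ρ.nonneg_normed t)
    _ = (variation u).toReal := by rw [integral_mul_const, ρ.integral_normed, one_mul]

lemma exists_contDiff_tendsto_variation_le (hu : AEStronglyMeasurable u)
    (huI : ∀ x, u x ∈ Set.Icc (0 : ℝ) 1) :
    ∃ w : ℕ → EuclideanSpace ℝ (Fin n) → ℝ, (∀ k, ContDiff ℝ 1 (w k)) ∧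
      (∀ k x, w k x ∈ Set.Icc (0 : ℝ) 1) ∧ (∀ k, variation (w k) ≤ variation u) ∧
      ∀ᵐ x, Tendsto (fun k => w k x) atTop (𝓝 (u x)) := by
  have hnorm (x : EuclideanSpace ℝ (Fin n)) : ‖u x‖ ≤ 1 := by
    simpa [abs_of_nonneg (huI x).1] using (huI x).2
  have hloc : LocallyIntegrable u := locallyIntegrable_of_norm_le hu hnorm
  let ρ (k : ℕ) : ContDiffBump (0 : EuclideanSpace ℝ (Fin n)) :=
    ⟨1 / (k + 1), 2 / (k + 1), by positivity, by gcongr; norm_num⟩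
  have hρ : Tendsto (fun k => (ρ k).rOut) atTop (𝓝 0) := by
    simpa [ρ, div_eq_mul_one_div (2 : ℝ)] using
      tendsto_one_div_add_atTop_nhds_zero_nat.const_mul (2 : ℝ)
  refine ⟨fun k => mollify (ρ k) u, fun k => contDiff_mollify _ hloc,
    fun k => mollify_mem_Icc _ huI, fun k => variation_mollify_le _ hu hnorm, ?_⟩
  refine ContDiffBump.ae_convolution_tendsto_right_of_locallyIntegrable (K := 2) hρ
    (.of_forall fun k => ?_) hloc
  simp [ρ, div_eq_mul_inv]

end Mollification

section Submodularity

lemma divergence_interpolate_add_divergence_interpolate (hu : DifferentiableAt ℝ u x)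
    (hv : DifferentiableAt ℝ v x) (hφ : DifferentiableAt ℝ φ x) (hψ : DifferentiableAt ℝ ψ x) :
    u x * divergence (v • φ + (1 - v) • ψ) x + v x * divergence (u • φ + (1 - u) • ψ) x =
      (u * v) x * divergence φ x + (u + v - u * v) x * divergence ψ x +
        divergence ((u * v) • (φ - ψ)) x := by
  have hfderiv_one_sub (w : EuclideanSpace ℝ (Fin n) → ℝ) :
      fderiv ℝ (1 - w) x = -fderiv ℝ w x := fderiv_const_sub 1
  have hu' : DifferentiableAt ℝ (1 - u) x := hu.const_sub 1
  have hv' : DifferentiableAt ℝ (1 - v) x := hv.const_sub 1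
  rw [divergence_add (hv.smul hφ) (hv'.smul hψ), divergence_add (hu.smul hφ) (hu'.smul hψ),
    divergence_smul hv hφ, divergence_smul hv' hψ, divergence_smul hu hφ, divergence_smul hu' hψ,
    divergence_smul (hu.mul hv) (hφ.sub hψ), divergence_sub hφ hψ, fderiv_mul hu hv,
    hfderiv_one_sub, hfderiv_one_sub]
  simp only [Pi.add_apply, Pi.sub_apply, Pi.mul_apply, Pi.one_apply, _root_.add_apply,
    _root_.smul_apply, _root_.neg_apply, map_sub, smul_eq_mul]
  ring

lemma integral_interpolate_add_integral_interpolate (hu : ContDiff ℝ 1 u) (hv : ContDiff ℝ 1 v)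
    (huI : ∀ x, u x ∈ Set.Icc (0 : ℝ) 1) (hvI : ∀ x, v x ∈ Set.Icc (0 : ℝ) 1)
    (hφ : IsTestField φ) (hψ : IsTestField ψ) :
    (∫ x, u x * divergence (v • φ + (1 - v) • ψ) x) +
        ∫ x, v x * divergence (u • φ + (1 - u) • ψ) x =
      (∫ x, (u * v) x * divergence φ x) + ∫ x, (u + v - u * v) x * divergence ψ x := by
  have hdiff : ContDiff ℝ 1 ((u * v) • (φ - ψ)) :=
    (hu.mul hv).smul (hφ.contDiff.sub hψ.contDiff)
  have hdiffc : HasCompactSupport ((u * v) • (φ - ψ)) :=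
    (hφ.hasCompactSupport.sub hψ.hasCompactSupport).smul_left
  have hint₁ := (hφ.smul_add_one_sub_smul hψ hv hvI).integrable_mul_divergence
    hu.continuous.locallyIntegrable
  have hint₂ := (hφ.smul_add_one_sub_smul hψ hu huI).integrable_mul_divergence
    hv.continuous.locallyIntegrable
  have hint₃ : Integrable fun x => (u * v) x * divergence φ x :=
    hφ.integrable_mul_divergence (hu.mul hv).continuous.locallyIntegrable
  have hint₄ : Integrable fun x => (u + v - u * v) x * divergence ψ x :=
    hψ.integrable_mul_divergence ((hu.add hv).sub (hu.mul hv)).continuous.locallyIntegrable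
  rw [← integral_add hint₁ hint₂, ← integral_add hint₃ hint₄, ← sub_eq_zero]
  refine (integral_sub (hint₁.add hint₂) (hint₃.add hint₄)).symm.trans ?_
  rw [← integral_divergence hdiff hdiffc]
  congr 1 with x
  exact sub_eq_iff_eq_add'.2 <| divergence_interpolate_add_divergence_interpolate
    (hu.differentiable one_ne_zero x) (hv.differentiable one_ne_zero x)
    (hφ.differentiable x) (hψ.differentiable x)

-- The products `u v` and `u + v - u v` are smooth substitutes for `min u v` and `max u v`, with
-- which they agree on indicators.
lemma variation_mul_add_variation_le (hu : AEStronglyMeasurable u) (hv : AEStronglyMeasurable v)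
    (huI : ∀ x, u x ∈ Set.Icc (0 : ℝ) 1) (hvI : ∀ x, v x ∈ Set.Icc (0 : ℝ) 1) :
    variation (u * v) + variation (u + v - u * v) ≤ variation u + variation v := by
  obtain ⟨f, hf, hfI, hfvar, hflim⟩ := exists_contDiff_tendsto_variation_le hu huI
  obtain ⟨g, hg, hgI, hgvar, hglim⟩ := exists_contDiff_tendsto_variation_le hv hvI
  refine variation_add_variation_le fun φ ψ hφ hψ => ?_
  have hmul : Tendsto (fun k => ∫ x, (f k * g k) x * divergence φ x) atTop
      (𝓝 (∫ x, (u * v) x * divergence φ x)) := by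
    refine tendsto_integral_mul_divergence (C := 1)
      (fun k => ((hf k).mul (hg k)).continuous.aestronglyMeasurable) (fun k x => ?_) ?_ hφ
    · have := unitInterval.mul_mem (hfI k x) (hgI k x)
      simpa [abs_of_nonneg (hfI k x).1, abs_of_nonneg (hgI k x).1] using this.2
    · filter_upwards [hflim, hglim] with x hfx hgx using hfx.mul hgx
  have hadd : Tendsto (fun k => ∫ x, (f k + g k - f k * g k) x * divergence ψ x) atTop
      (𝓝 (∫ x, (u + v - u * v) x * divergence ψ x)) := by
    refine tendsto_integral_mul_divergence (C := 1)
      (fun k => (((hf k).add (hg k)).sub ((hf k).mul (hg k))).continuous.aestronglyMeasurable)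
      (fun k x => ?_) ?_ hψ
    · obtain ⟨⟨hf0, hf1⟩, hg0, hg1⟩ := And.intro (hfI k x) (hgI k x)
      simp only [Pi.sub_apply, Pi.add_apply, Pi.mul_apply, Real.norm_eq_abs, abs_le]
      constructor <;> nlinarith
    · filter_upwards [hflim, hglim] with x hfx hgx using (hfx.add hgx).sub (hfx.mul hgx)
  refine le_of_tendsto' (ENNReal.tendsto_ofReal (hmul.add hadd)) fun k => ?_
  rw [← integral_interpolate_add_integral_interpolate (hf k) (hg k) (hfI k) (hgI k) hφ hψ]
  exact ENNReal.ofReal_add_le.trans <| add_le_add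
    (((hφ.smul_add_one_sub_smul hψ (hg k) (hgI k)).ofReal_integral_le_variation _).trans (hfvar k))
    (((hφ.smul_add_one_sub_smul hψ (hf k) (hfI k)).ofReal_integral_le_variation _).trans (hgvar k))

theorem perimeter_inter_add_perimeter_union_le (hA : NullMeasurableSet A)
    (hB : NullMeasurableSet B) :
    perimeter (A ∩ B) + perimeter (A ∪ B) ≤ perimeter A + perimeter B := by
  have hmeas {S : Set (EuclideanSpace ℝ (Fin n))} (hS : NullMeasurableSet S) :
      AEStronglyMeasurable (S.indicator (1 : EuclideanSpace ℝ (Fin n) → ℝ)) :=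
    aestronglyMeasurable_const.indicator₀ hS
  have hI (S : Set (EuclideanSpace ℝ (Fin n))) (x : EuclideanSpace ℝ (Fin n)) :
      S.indicator 1 x ∈ Set.Icc (0 : ℝ) 1 := by
    by_cases hx : x ∈ S <;> simp [hx]
  have hunion : (A ∪ B).indicator (1 : EuclideanSpace ℝ (Fin n) → ℝ) =
      A.indicator 1 + B.indicator 1 - A.indicator 1 * B.indicator 1 := by
    rw [← Set.inter_indicator_one, ← Set.indicator_union_add_inter, add_sub_cancel_right]
  rw [← variation_indicator hA, ← variation_indicator hB, ← variation_indicator (hA.inter hB),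
    ← variation_indicator (hA.union hB), hunion, Set.inter_indicator_one]
  exact variation_mul_add_variation_le (hmeas hA) (hmeas hB) (hI A) (hI B)

end Submodularity

section Cutoff

variable {V : Type*} {ρ : V → ℝ} {τ δ : ℝ}

lemma exists_lipschitzWith_smoothTransition : ∃ C > 0, LipschitzWith C Real.smoothTransition := by
  have hdiff : ContDiff ℝ 1 Real.smoothTransition := Real.smoothTransition.contDiff
  have hsupp : HasCompactSupport (deriv Real.smoothTransition) := by
    refine .intro (isCompact_Icc (a := (0 : ℝ)) (b := 1)) fun t ht => ?_
    rcases not_and_or.1 ht with ht | ht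
    · refine IsLocalMin.deriv_eq_zero (.of_forall fun s => ?_)
      rw [Real.smoothTransition.zero_of_nonpos (not_le.1 ht).le]
      exact Real.smoothTransition.nonneg s
    · refine IsLocalMax.deriv_eq_zero (.of_forall fun s => ?_)
      rw [Real.smoothTransition.one_of_one_le (not_le.1 ht).le]
      exact Real.smoothTransition.le_one s
  obtain ⟨C, hC⟩ := (hdiff.continuous_deriv le_rfl).bounded_above_of_compact_support hsupp
  refine ⟨C.toNNReal + 1, by positivity, lipschitzWith_of_nnnorm_deriv_le
    (hdiff.differentiable one_ne_zero) fun t => ?_⟩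
  exact (NNReal.le_toNNReal_of_coe_le (hC t)).trans le_self_add

lemma exists_contDiff_lipschitzWith_norm_le (V : Type*) [NormedAddCommGroup V]
    [InnerProductSpace ℝ V] :
    ∃ ρ : V → ℝ, ContDiff ℝ 1 ρ ∧ LipschitzWith 1 ρ ∧ ∀ x, ‖x‖ ≤ ρ x := by
  -- `√(1 + ‖x‖²)`
  refine ⟨fun x => ‖WithLp.toLp 2 ((1 : ℝ), x)‖, ?_, .of_dist_le_mul fun x y => ?_, fun x => ?_⟩
  · refine ContDiff.norm ℝ (WithLp.contDiff_toLp.comp (contDiff_const.prodMk contDiff_id))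
      fun x hx => ?_
    simpa using congrArg WithLp.fst hx
  · refine (abs_norm_sub_norm_le _ _).trans_eq ?_
    rw [← WithLp.toLp_sub, Prod.mk_sub_mk, sub_self, WithLp.norm_toLp_snd, NNReal.coe_one, one_mul,
      dist_eq_norm]
  · exact WithLp.norm_snd_le _ (WithLp.toLp 2 ((1 : ℝ), x))

/-- A cutoff function passing from `1` to `0` where `τ ≤ ρ ≤ τ + δ`. -/
def cutoff (ρ : V → ℝ) (τ δ : ℝ) (x : V) : ℝ :=
  Real.smoothTransition ((τ + δ - ρ x) / δ)

lemma cutoff_mem_Icc (ρ : V → ℝ) (τ δ : ℝ) (x : V) : cutoff ρ τ δ x ∈ Set.Icc (0 : ℝ) 1 :=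
  ⟨Real.smoothTransition.nonneg _, Real.smoothTransition.le_one _⟩

lemma cutoff_eq_one (hδ : 0 < δ) {x : V} (hx : ρ x ≤ τ) : cutoff ρ τ δ x = 1 :=
  Real.smoothTransition.one_of_one_le ((one_le_div hδ).2 (by linarith))

lemma cutoff_eq_zero (hδ : 0 < δ) {x : V} (hx : τ + δ ≤ ρ x) : cutoff ρ τ δ x = 0 :=
  Real.smoothTransition.zero_of_nonpos (div_nonpos_of_nonpos_of_nonneg (by linarith) hδ.le)

lemma tendsto_cutoff (ρ : V → ℝ) (τ : ℝ) (x : V) :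
    Tendsto (fun δ => cutoff ρ τ δ x) (𝓝[>] 0) (𝓝 ((ρ ⁻¹' Set.Iic τ).indicator 1 x)) := by
  refine tendsto_const_nhds.congr' ?_
  by_cases hx : ρ x ≤ τ
  · filter_upwards [self_mem_nhdsWithin] with δ hδ
    simp [hx, cutoff_eq_one hδ hx]
  · filter_upwards [Ioo_mem_nhdsGT (sub_pos.2 (not_le.1 hx))] with δ hδ
    simp [hx, cutoff_eq_zero hδ.1 (le_sub_iff_add_le'.1 hδ.2.le)]

variable [NormedAddCommGroup V] [NormedSpace ℝ V]

lemma contDiff_cutoff (hρ : ContDiff ℝ 1 ρ) (τ δ : ℝ) : ContDiff ℝ 1 (cutoff ρ τ δ) :=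
  Real.smoothTransition.contDiff.comp ((contDiff_const.sub hρ).div_const δ)

lemma fderiv_cutoff_eq_zero (hδ : 0 < δ) {x : V} (hx : ρ x ∉ Set.Ioc τ (τ + δ)) :
    fderiv ℝ (cutoff ρ τ δ) x = 0 := by
  rcases not_and_or.1 hx with hx | hx
  · refine IsLocalMax.fderiv_eq_zero (.of_forall fun y => ?_)
    rw [cutoff_eq_one hδ (not_lt.1 hx)]
    exact (cutoff_mem_Icc ρ τ δ y).2
  · refine IsLocalMin.fderiv_eq_zero (.of_forall fun y => ?_)
    rw [cutoff_eq_zero hδ (not_le.1 hx).le]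
    exact (cutoff_mem_Icc ρ τ δ y).1

lemma norm_fderiv_cutoff_le {C : ℝ≥0} (hC : LipschitzWith C Real.smoothTransition)
    (hρ : LipschitzWith 1 ρ) (τ : ℝ) (hδ : 0 < δ) (x : V) :
    ‖fderiv ℝ (cutoff ρ τ δ) x‖ ≤ C / δ := by
  refine norm_fderiv_le_of_lip' ℝ (by positivity) (.of_forall fun y => ?_)
  calc ‖cutoff ρ τ δ y - cutoff ρ τ δ x‖
      ≤ C * ‖(τ + δ - ρ y) / δ - (τ + δ - ρ x) / δ‖ := hC.norm_sub_le _ _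
    _ = C / δ * ‖ρ x - ρ y‖ := by
        rw [← sub_div, sub_sub_sub_cancel_left, norm_div, Real.norm_of_nonneg hδ.le]
        ring
    _ ≤ C / δ * ‖y - x‖ := by
        gcongr
        simpa [norm_sub_rev] using hρ.norm_sub_le x y

end Cutoff

section MonotoneDerivative

lemma exists_hasDerivAt_le_of_monotone {m : ℝ → ℝ} (hm : Monotone m) {a b c : ℝ} (hab : a ≤ b)
    (hc : m b - m a < c * (b - a)) :
    ∃ τ ∈ Set.Icc a b, ∃ m' ≤ c, HasDerivAt m m' τ := by
  by_contra! hcon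
  have hle : ∫ x in a..b, deriv m x ≤ m b - m a := by
    have := (hm.monotoneOn (Set.uIcc a b)).intervalIntegral_deriv_mem_uIcc
    rw [Set.uIcc_of_le (sub_nonneg.2 (hm hab))] at this
    exact this.2
  have hge : ∫ _ in a..b, c ≤ ∫ x in a..b, deriv m x := by
    refine intervalIntegral.integral_mono_ae_restrict hab (by simp)
      (hm.monotoneOn _).intervalIntegrable_deriv ?_
    rw [EventuallyLE, ae_restrict_iff' measurableSet_Icc]
    filter_upwards [hm.ae_differentiableAt] with x hx hxab
    exact le_of_not_ge fun hle => hcon x hxab _ hle hx.hasDerivAt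
  rw [intervalIntegral.integral_const, smul_eq_mul, mul_comm] at hge
  linarith

lemma exists_tendsto_measureReal_Ioc_div (ν : Measure ℝ) [IsFiniteMeasure ν] (R : ℝ) {ε : ℝ}
    (hε : 0 < ε) :
    ∃ τ ≥ R, ∃ c ≤ ε, Tendsto (fun δ => ν.real (Set.Ioc τ (τ + δ)) / δ) (𝓝[>] 0) (𝓝 c) := by
  have hmono : Monotone fun t => ν.real (Set.Iic t) := fun _ _ hst =>
    measureReal_mono (Set.Iic_subset_Iic.2 hst)
  have hR : R ≤ R + (ν.real Set.univ + 1) / ε := le_add_of_nonneg_right (by positivity)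
  obtain ⟨τ, hτ, c, hcε, hc⟩ := exists_hasDerivAt_le_of_monotone (c := ε) hmono hR <| by
    have hupper := measureReal_mono (μ := ν)
      (Set.subset_univ (Set.Iic (R + (ν.real Set.univ + 1) / ε)))
    have hlower : 0 ≤ ν.real (Set.Iic R) := measureReal_nonneg
    rw [add_sub_cancel_left, mul_div_cancel₀ _ hε.ne']
    linarith
  refine ⟨τ, hτ.1, c, hcε, (hc.tendsto_slope_zero_right).congr' ?_⟩
  filter_upwards [self_mem_nhdsWithin] with δ hδ
  rw [← Set.Iic_sdiff_Iic, measureReal_sdiff (Set.Iic_subset_Iic.2 (by linarith [Set.mem_Ioi.1 hδ]))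
    measurableSet_Iic, smul_eq_mul, inv_mul_eq_div]

end MonotoneDerivative


section Truncation

variable {ρ : EuclideanSpace ℝ (Fin n) → ℝ} {τ δ ε : ℝ} {C : ℝ≥0}

lemma locallyIntegrable_indicator_one (hA : NullMeasurableSet A) :
    LocallyIntegrable (A.indicator (1 : EuclideanSpace ℝ (Fin n) → ℝ)) :=
  locallyIntegrable_of_norm_le (C := 1) (aestronglyMeasurable_const.indicator₀ hA) fun x => by
    by_cases hx : x ∈ A <;> simp [hx]

lemma integral_glue_mul_divergence (hu : LocallyIntegrable u) (hv : LocallyIntegrable v)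
    (hχ : ContDiff ℝ 1 χ) (hχI : ∀ x, χ x ∈ Set.Icc (0 : ℝ) 1) (hφ : IsTestField φ) :
    ∫ x, ((1 - χ) * u + χ * v) x * divergence φ x =
      (∫ x, u x * divergence ((1 - χ) • φ) x) + (∫ x, v x * divergence (χ • φ) x) +
        ∫ x, (u x - v x) * fderiv ℝ χ x (φ x) := by
  have hχ' : ContDiff ℝ 1 (1 - χ) := contDiff_const.sub hχ
  have hχI' (x : EuclideanSpace ℝ (Fin n)) : (1 - χ) x ∈ Set.Icc (0 : ℝ) 1 :=
    Set.Icc.mem_iff_one_sub_mem.1 (hχI x)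
  have hint₁ := (hφ.smul hχ' hχI').integrable_mul_divergence hu
  have hint₂ := (hφ.smul hχ hχI).integrable_mul_divergence hv
  have hint₃ : Integrable fun x => (u x - v x) * fderiv ℝ χ x (φ x) :=
    (hu.sub hv).integrable_smul_right_of_hasCompactSupport
      ((hχ.continuous_fderiv one_ne_zero).clm_apply hφ.contDiff.continuous)
      (hφ.hasCompactSupport.mono fun x hx h0 => hx (by simp [h0]))
  rw [← integral_add hint₁ hint₂]
  refine Eq.trans ?_ (integral_add (hint₁.add hint₂) hint₃)
  congr 1 with x
  have hχx := hχ.differentiable one_ne_zero x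
  have hχx' : DifferentiableAt ℝ (1 - χ) x := hχx.const_sub 1
  have hfderiv : fderiv ℝ (1 - χ) x = -fderiv ℝ χ x := fderiv_const_sub 1
  rw [divergence_smul hχx' (hφ.differentiable x), divergence_smul hχx (hφ.differentiable x),
    hfderiv]
  simp only [Pi.add_apply, Pi.sub_apply, Pi.mul_apply, Pi.one_apply, _root_.neg_apply]
  ring

lemma integral_indicator_sub_mul_fderiv_cutoff_le (hEG : E ⊆ G) (hvol : volume (G \ E) ≠ ⊤)
    (hC : LipschitzWith C Real.smoothTransition) (hρ : LipschitzWith 1 ρ) (hδ : 0 < δ)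
    (hφ : IsTestField φ) :
    ∫ x, (E.indicator 1 x - G.indicator 1 x) * fderiv ℝ (cutoff ρ τ δ) x (φ x) ≤
      C * (((volume.restrict (G \ E)).map ρ).real (Set.Ioc τ (τ + δ)) / δ) := by
  have hmeas : MeasurableSet (ρ ⁻¹' Set.Ioc τ (τ + δ)) :=
    measurableSet_Ioc.preimage hρ.continuous.measurable
  rw [map_measureReal_apply hρ.continuous.measurable measurableSet_Ioc,
    measureReal_restrict_apply hmeas, ← setIntegral_eq_integral_of_forall_compl_eq_zero
      (s := ρ ⁻¹' Set.Ioc τ (τ + δ) ∩ (G \ E))]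
  · refine (Real.le_norm_self _).trans ((norm_setIntegral_le_of_norm_le_const (C := C / δ)
      (measure_inter_lt_top_of_right_ne_top hvol) fun x hx => ?_).trans_eq (by ring))
    have hindicator : E.indicator 1 x - G.indicator 1 x = (-1 : ℝ) := by
      simp [hx.2.1, hx.2.2]
    rw [hindicator, norm_mul, norm_neg, norm_one, one_mul]
    calc ‖fderiv ℝ (cutoff ρ τ δ) x (φ x)‖
        ≤ ‖fderiv ℝ (cutoff ρ τ δ) x‖ * ‖φ x‖ := le_opNorm _ _
      _ ≤ C / δ * 1 := by
          gcongr
          · exact norm_fderiv_cutoff_le hC hρ τ hδ x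
          · exact hφ.norm_le_one x
      _ = C / δ := mul_one _
  · intro x hx
    rcases not_and_or.1 hx with hx | hx
    · rw [fderiv_cutoff_eq_zero hδ hx, _root_.zero_apply, mul_zero]
    · by_cases hxE : x ∈ E
      · simp [hxE, hEG hxE]
      · have hxG : x ∉ G := fun hxG => hx ⟨hxG, hxE⟩
        simp [hxE, hxG]

lemma variation_glue_cutoff_le (hE : NullMeasurableSet E) (hG : NullMeasurableSet G) (hEG : E ⊆ G)
    (hvol : volume (G \ E) ≠ ⊤) (hC : LipschitzWith C Real.smoothTransition)
    (hρ : ContDiff ℝ 1 ρ) (hρ' : LipschitzWith 1 ρ) (hδ : 0 < δ)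
    (hfar : ∀ ψ, IsTestField ψ → (∀ x, ρ x ≤ τ → ψ x = 0) →
      ∫ x, E.indicator 1 x * divergence ψ x ≤ ε) :
    variation ((1 - cutoff ρ τ δ) * E.indicator 1 + cutoff ρ τ δ * G.indicator 1) ≤
      perimeter G + ENNReal.ofReal (ε +
        C * (((volume.restrict (G \ E)).map ρ).real (Set.Ioc τ (τ + δ)) / δ)) := by
  refine iSup₂_le fun φ hφ => ?_
  have hχ := contDiff_cutoff hρ τ δ
  have hχI := cutoff_mem_Icc ρ τ δ
  have hnear := (hφ.smul hχ hχI).ofReal_integral_le_variation (G.indicator 1)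
  rw [variation_indicator hG] at hnear
  have houter := hfar ((1 - cutoff ρ τ δ) • φ)
    (hφ.smul (contDiff_const.sub hχ) fun x => Set.Icc.mem_iff_one_sub_mem.1 (hχI x))
    fun x hx => by simp [cutoff_eq_one hδ hx]
  have hlayer := integral_indicator_sub_mul_fderiv_cutoff_le (τ := τ) hEG hvol hC hρ' hδ hφ
  rw [integral_glue_mul_divergence (locallyIntegrable_indicator_one hE)
    (locallyIntegrable_indicator_one hG) hχ hχI hφ, add_right_comm, add_comm]
  exact ENNReal.ofReal_add_le.trans
    (add_le_add hnear (ENNReal.ofReal_le_ofReal (add_le_add houter hlayer)))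

lemma perimeter_union_inter_sublevel_le (hE : NullMeasurableSet E) (hG : NullMeasurableSet G)
    (hEG : E ⊆ G) (hvol : volume (G \ E) ≠ ⊤) (hC : LipschitzWith C Real.smoothTransition)
    (hρ : ContDiff ℝ 1 ρ) (hρ' : LipschitzWith 1 ρ)
    (hfar : ∀ ψ, IsTestField ψ → (∀ x, ρ x ≤ τ → ψ x = 0) →
      ∫ x, E.indicator 1 x * divergence ψ x ≤ ε) {c : ℝ}
    (hc : Tendsto (fun δ => ((volume.restrict (G \ E)).map ρ).real (Set.Ioc τ (τ + δ)) / δ)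
      (𝓝[>] 0) (𝓝 c)) :
    perimeter (E ∪ G ∩ ρ ⁻¹' Set.Iic τ) ≤ perimeter G + ENNReal.ofReal (ε + C * c) := by
  have hsub : MeasurableSet (ρ ⁻¹' Set.Iic τ) :=
    measurableSet_Iic.preimage hρ'.continuous.measurable
  rw [← variation_indicator (hE.union (hG.inter hsub.nullMeasurableSet))]
  refine (variation_le_liminf (l := 𝓝[>] (0 : ℝ)) (C := 1)
    (w := fun δ => (1 - cutoff ρ τ δ) * E.indicator 1 + cutoff ρ τ δ * G.indicator 1)
    (fun δ => ?_) (fun δ x => ?_) (.of_forall fun x => ?_)).trans ?_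
  · have hχ := (contDiff_cutoff hρ τ δ).continuous.aestronglyMeasurable (μ := volume)
    exact ((aestronglyMeasurable_const.sub hχ).mul (aestronglyMeasurable_const.indicator₀ hE)).add
      (hχ.mul (aestronglyMeasurable_const.indicator₀ hG))
  · obtain ⟨h0, h1⟩ := cutoff_mem_Icc ρ τ δ x
    by_cases hxE : x ∈ E
    · simp [hxE, hEG hxE]
    · by_cases hxG : x ∈ G <;> simp [hxE, hxG, abs_of_nonneg h0, h1]
  · have hlim := tendsto_cutoff ρ τ x
    have hvalue : (E ∪ G ∩ ρ ⁻¹' Set.Iic τ).indicator (1 : EuclideanSpace ℝ (Fin n) → ℝ) x =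
        (1 - (ρ ⁻¹' Set.Iic τ).indicator 1 x) * E.indicator 1 x +
          (ρ ⁻¹' Set.Iic τ).indicator 1 x * G.indicator 1 x := by
      by_cases hxE : x ∈ E
      · simp [hxE, hEG hxE]
      · by_cases hxG : x ∈ G <;> by_cases hxτ : ρ x ≤ τ <;> simp [hxE, hxG, hxτ]
    rw [hvalue]
    exact ((hlim.const_sub 1).mul_const _).add (hlim.mul_const _)
  · refine (liminf_le_liminf ?_).trans_eq
      (((ENNReal.tendsto_ofReal ((hc.const_mul _).const_add _)).const_add _).liminf_eq)
    filter_upwards [self_mem_nhdsWithin] with δ hδ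
    exact variation_glue_cutoff_le hE hG hEG hvol hC hρ hρ' hδ hfar

theorem exists_isBounded_diff_perimeter_le (hE : NullMeasurableSet E) (hG : NullMeasurableSet G)
    (hEG : E ⊆ G) (hvol : volume (G \ E) ≠ ⊤) (hper : perimeter E ≠ ⊤) (hε : 0 < ε) :
    ∃ H, NullMeasurableSet H ∧ E ⊆ H ∧ Bornology.IsBounded (H \ E) ∧
      perimeter H ≤ perimeter G + ENNReal.ofReal ε := by
  obtain ⟨C, hCpos, hC⟩ := exists_lipschitzWith_smoothTransition
  obtain ⟨ρ, hρ, hρ', hnorm⟩ := exists_contDiff_lipschitzWith_norm_le (EuclideanSpace ℝ (Fin n))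
  obtain ⟨K, hK, hKε⟩ := exists_isCompact_forall_integral_le (locallyIntegrable_indicator_one hE)
    (by rwa [variation_indicator hE]) (half_pos hε)
  obtain ⟨R, hR⟩ := hK.bddAbove_image hρ.continuous.continuousOn
  have : IsFiniteMeasure (volume.restrict (G \ E)) := isFiniteMeasure_restrict.2 hvol
  obtain ⟨τ, hτ, c, hcε, hc⟩ := exists_tendsto_measureReal_Ioc_div
    ((volume.restrict (G \ E)).map ρ) R (div_pos (half_pos hε) (NNReal.coe_pos.2 hCpos))
  have hfar (ψ : EuclideanSpace ℝ (Fin n) → EuclideanSpace ℝ (Fin n)) (hψ : IsTestField ψ)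
      (hψ0 : ∀ x, ρ x ≤ τ → ψ x = 0) : ∫ x, E.indicator 1 x * divergence ψ x ≤ ε / 2 :=
    hKε ψ hψ fun x hx => hψ0 x ((hR (Set.mem_image_of_mem ρ hx)).trans hτ)
  have hsub : MeasurableSet (ρ ⁻¹' Set.Iic τ) := measurableSet_Iic.preimage hρ.continuous.measurable
  refine ⟨E ∪ G ∩ ρ ⁻¹' Set.Iic τ, hE.union (hG.inter hsub.nullMeasurableSet),
    Set.subset_union_left, ?_,
    (perimeter_union_inter_sublevel_le hE hG hEG hvol hC hρ hρ' hfar hc).trans ?_⟩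
  · refine (Metric.isBounded_closedBall (x := 0) (r := τ)).subset fun x hx => ?_
    exact mem_closedBall_zero_iff.2 ((hnorm x).trans (hx.1.resolve_left hx.2).2)
  · gcongr
    linarith [(le_div_iff₀' (NNReal.coe_pos.2 hCpos)).1 hcε]

lemma IsMinimizingHull.nullMeasurableSet (hE : IsMinimizingHull E) : NullMeasurableSet E :=
  nullMeasurableSet_of_null_frontier hE.frontier_null

theorem IsMinimizingHull.perimeter_le_of_volume_diff_ne_top (hE : IsMinimizingHull E)
    (hper : perimeter E ≠ ⊤) (hG : NullMeasurableSet G) (hEG : E ⊆ G)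
    (hvol : volume (G \ E) ≠ ⊤) : perimeter E ≤ perimeter G := by
  refine ENNReal.le_of_forall_pos_le_add fun ε hε _ => ?_
  obtain ⟨H, hH, hEH, hbounded, hle⟩ := exists_isBounded_diff_perimeter_le
    hE.nullMeasurableSet hG hEG hvol hper (NNReal.coe_pos.2 hε)
  rw [ENNReal.ofReal_coe_nnreal] at hle
  exact (hE.perimeter_le H hH hEH hbounded).trans hle

end Truncation

section Comparison

variable {h : ℝ}

/-- The measure with density `dist(·, ∂E)`, so that the second term of the energy is the
`1 / h`-multiple of the mass of `F Δ E`. -/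
def distMeasure (E : Set (EuclideanSpace ℝ (Fin n))) : Measure (EuclideanSpace ℝ (Fin n)) :=
  volume.withDensity fun x => Metric.infEDist x (frontier E)

lemma distMeasure_absolutelyContinuous (E : Set (EuclideanSpace ℝ (Fin n))) :
    distMeasure E ≪ volume :=
  withDensity_absolutelyContinuous _ _

lemma energy_eq (h : ℝ) (E F : Set (EuclideanSpace ℝ (Fin n))) :
    energy h E F = perimeter F + ENNReal.ofReal (1 / h) * distMeasure E (symmDiff F E) := by
  rw [energy, distMeasure, withDensity_apply']

lemma volume_eq_zero_of_distMeasure_eq_zero (hE : volume (frontier E) = 0)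
    (hA : NullMeasurableSet A) (hnull : distMeasure E A = 0) : volume A = 0 := by
  rw [distMeasure, withDensity_apply', lintegral_eq_zero_iff Metric.continuous_infEDist.measurable,
    EventuallyEq, ae_restrict_iff'₀ hA] at hnull
  refine measure_mono_null_ae ?_ hE
  filter_upwards [hnull] with x hx hxA
  exact (Metric.mem_iff_infEDist_zero_of_closed isClosed_frontier).2 (hx hxA)

lemma distMeasure_symmDiff_eq_add (hA : NullMeasurableSet A) (hB : NullMeasurableSet B)
    (hBA : B ⊆ A) (hAE : volume (A \ E) = 0) :
    distMeasure E (symmDiff B E) = distMeasure E (symmDiff A E) + distMeasure E (A \ B) := by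
  have hac := distMeasure_absolutelyContinuous E
  have hnotMem : ∀ᵐ x ∂distMeasure E, x ∉ A \ E := measure_eq_zero_iff_ae_notMem.1 (hac hAE)
  have hdisj : AEDisjoint (distMeasure E) (symmDiff A E) (A \ B) :=
    measure_mono_null (t := A \ E)
      (fun x hx => ⟨hx.2.1, (hx.1.resolve_right fun hxE => hxE.2 hx.2.1).2⟩) (hac hAE)
  rw [← measure_union₀ ((hA.diff hB).mono_ac hac) hdisj]
  refine measure_congr (eventuallyEq_set.2 ?_)
  filter_upwards [hnotMem] with x hx
  have hxBA : x ∈ B → x ∈ A := @hBA x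
  simp only [Set.mem_symmDiff, Set.mem_union, Set.mem_sdiff] at hx ⊢
  tauto

lemma IsMinimizingHull.perimeter_inter_le (hE : IsMinimizingHull E) (hper : perimeter E ≠ ⊤)
    (hF : NullMeasurableSet F) (hvol : volume (F \ E) ≠ ⊤) :
    perimeter (F ∩ E) ≤ perimeter F := by
  have hunion : perimeter E ≤ perimeter (F ∪ E) :=
    hE.perimeter_le_of_volume_diff_ne_top hper (hF.union hE.nullMeasurableSet)
      Set.subset_union_right (by rwa [Set.union_sdiff_right])
  exact (ENNReal.add_le_add_iff_right hper).1 <| (add_le_add_right hunion _).trans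
    (perimeter_inter_add_perimeter_union_le hF hE.nullMeasurableSet)

lemma distMeasure_symmDiff_ne_top (hh : 0 < h) (hfin : energy h E F ≠ ⊤) :
    distMeasure E (symmDiff F E) ≠ ⊤ := by
  rw [energy_eq] at hfin
  exact (ENNReal.lt_top_of_mul_ne_top_right (ENNReal.add_ne_top.1 hfin).2 (by simpa using hh)).ne

namespace IsStepMinimizer

lemma energy_ne_top (hF : IsStepMinimizer h Ω E F) (hE : NullMeasurableSet E)
    (hper : perimeter E ≠ ⊤) (hΩ : Ω ⊆ E) : energy h E F ≠ ⊤ := by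
  have hself : energy h E E = perimeter E := by simp [energy]
  exact ne_top_of_le_ne_top (hself.trans_ne hper) (hF.energy_le E ⟨hE, hΩ, by simp⟩)

theorem volume_diff_eq_zero (hF : IsStepMinimizer h Ω E F) (hh : 0 < h) (hE : IsMinimizingHull E)
    (hper : perimeter E ≠ ⊤) (hΩ : Ω ⊆ E) : volume (F \ E) = 0 := by
  have hEm := hE.nullMeasurableSet
  have hFm := hF.admissible.measurable
  have hsymm : symmDiff (F ∩ E) E = E \ F := by
    rw [Set.symmDiff_def, Set.inter_sdiff_assoc, Set.sdiff_self, Set.inter_empty,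
      Set.empty_union, Set.sdiff_inter_self_eq_sdiff]
  have hsplit : distMeasure E (symmDiff F E) = distMeasure E (F \ E) + distMeasure E (E \ F) :=
    measure_union₀ ((hEm.diff hFm).mono_ac (distMeasure_absolutelyContinuous E))
      disjoint_sdiff_sdiff.aedisjoint
  have hle := hF.energy_le (F ∩ E) ⟨hFm.inter hEm,
    Set.subset_inter hF.admissible.obstacle_subset hΩ, by simp [Set.inter_sdiff_assoc]⟩
  have hfin := hF.energy_ne_top hEm hper hΩ
  rw [energy_eq, hsplit, mul_add, add_left_comm] at hle hfin
  rw [energy_eq, hsymm] at hle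
  have hzero : ENNReal.ofReal (1 / h) * distMeasure E (F \ E) ≤ 0 := by
    refine (ENNReal.add_le_add_iff_right (ENNReal.add_ne_top.1 hfin).2).1 ?_
    rw [zero_add]
    exact hle.trans (add_le_add_left
      (hE.perimeter_inter_le hper hFm hF.admissible.finite_excess.ne) _)
  refine volume_eq_zero_of_distMeasure_eq_zero hE.frontier_null (hFm.diff hEm) ?_
  exact (mul_eq_zero.1 (nonpos_iff_eq_zero.1 hzero)).resolve_left (by simpa using hh)

lemma perimeter_le_of_subset (hF : IsStepMinimizer h Ω E F) (hfin : energy h E F ≠ ⊤)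
    (hFE : volume (F \ E) = 0) (hA : NullMeasurableSet A) (hΩA : Ω ⊆ A) (hAF : A ⊆ F) :
    perimeter F ≤ perimeter A + ENNReal.ofReal (1 / h) * distMeasure E (F \ A) := by
  have hAE : volume (A \ E) = 0 := measure_mono_null (Set.sdiff_subset_sdiff_left hAF) hFE
  have hle := hF.energy_le A ⟨hA, hΩA, by simp [hAE]⟩
  rw [energy_eq] at hle hfin
  rw [energy_eq, distMeasure_symmDiff_eq_add hF.admissible.measurable hA hAF hFE, mul_add,
    add_left_comm, add_comm] at hle
  exact (ENNReal.add_le_add_iff_left (ENNReal.add_ne_top.1 hfin).2).1 hle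

lemma perimeter_add_le_of_superset (hF : IsStepMinimizer h Ω E F) (hfin : energy h E F ≠ ⊤)
    (hA : NullMeasurableSet A) (hFA : F ⊆ A) (hAE : volume (A \ E) = 0) :
    perimeter F + ENNReal.ofReal (1 / h) * distMeasure E (A \ F) ≤ perimeter A := by
  have hle := hF.energy_le A ⟨hA, hF.admissible.obstacle_subset.trans hFA, by simp [hAE]⟩
  rw [energy_eq, distMeasure_symmDiff_eq_add hA hF.admissible.measurable hFA hAE, mul_add]
    at hle hfin
  rw [energy_eq, add_left_comm, add_comm (perimeter A)] at hle
  exact (ENNReal.add_le_add_iff_left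
    (ENNReal.add_ne_top.1 (ENNReal.add_ne_top.1 hfin).2).1).1 hle

lemma mul_distMeasure_diff_le {h' : ℝ} {F' : Set (EuclideanSpace ℝ (Fin n))}
    (hF : IsStepMinimizer h Ω E F) (hF' : IsStepMinimizer h' Ω E F') (hfin : energy h E F ≠ ⊤)
    (hfin' : energy h' E F' ≠ ⊤) (hFE : volume (F \ E) = 0) (hFE' : volume (F' \ E) = 0) :
    ENNReal.ofReal (1 / h') * distMeasure E (F \ F') ≤
      ENNReal.ofReal (1 / h) * distMeasure E (F \ F') := by
  have hFm := hF.admissible.measurable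
  have hFm' := hF'.admissible.measurable
  have hinter := hF.perimeter_le_of_subset hfin hFE (hFm.inter hFm')
    (Set.subset_inter hF.admissible.obstacle_subset hF'.admissible.obstacle_subset)
    Set.inter_subset_left
  have hunion := hF'.perimeter_add_le_of_superset hfin' (hFm.union hFm') Set.subset_union_right
    (by simp [Set.union_sdiff_distrib, hFE, hFE'])
  rw [Set.sdiff_self_inter] at hinter
  rw [Set.union_sdiff_right] at hunion
  have hper : perimeter F + perimeter F' ≠ ⊤ := ENNReal.add_ne_top.2
    ⟨ne_top_of_le_ne_top hfin le_self_add, ne_top_of_le_ne_top hfin' le_self_add⟩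
  refine (ENNReal.add_le_add_iff_left hper).1 ?_
  set I := distMeasure E (F \ F')
  calc perimeter F + perimeter F' + ENNReal.ofReal (1 / h') * I
      = perimeter F + (perimeter F' + ENNReal.ofReal (1 / h') * I) := add_assoc _ _ _
    _ ≤ perimeter (F ∩ F') + ENNReal.ofReal (1 / h) * I + perimeter (F ∪ F') :=
        add_le_add hinter hunion
    _ = perimeter (F ∩ F') + perimeter (F ∪ F') + ENNReal.ofReal (1 / h) * I :=
        add_right_comm _ _ _
    _ ≤ perimeter F + perimeter F' + ENNReal.ofReal (1 / h) * I :=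
        add_le_add_left (perimeter_inter_add_perimeter_union_le hFm hFm') _

end IsStepMinimizer

end Comparison

end ObstacleFlow

end

theorem mainTheorem10_general {n : ℕ} {Ω E F F' : Set (EuclideanSpace ℝ (Fin n))} {h h' : ℝ}
    (hE : ObstacleFlow.IsMinimizingHull E) (hper : ObstacleFlow.perimeter E < ⊤) (hΩ : Ω ⊆ E)
    (hpos : 0 < h') (hlt : h' < h) (hF : ObstacleFlow.IsStepMinimizer h Ω E F)
    (hF' : ObstacleFlow.IsStepMinimizer h' Ω E F') : volume (F \ F') = 0 := by
  have hfin := hF.energy_ne_top hE.nullMeasurableSet hper.ne hΩ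
  have hfin' := hF'.energy_ne_top hE.nullMeasurableSet hper.ne hΩ
  have hle := hF.mul_distMeasure_diff_le hF' hfin hfin'
    (hF.volume_diff_eq_zero (hpos.trans hlt) hE hper.ne hΩ)
    (hF'.volume_diff_eq_zero hpos hE hper.ne hΩ)
  have hne : ObstacleFlow.distMeasure E (F \ F') ≠ ⊤ := by
    have hsub : F \ F' ⊆ symmDiff F E ∪ symmDiff F' E := by
      rw [symmDiff_comm F' E]
      exact le_sup_left.trans (symmDiff_triangle F E F')
    exact ne_top_of_le_ne_top (ENNReal.add_ne_top.2
      ⟨ObstacleFlow.distMeasure_symmDiff_ne_top (hpos.trans hlt) hfin,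
        ObstacleFlow.distMeasure_symmDiff_ne_top hpos hfin'⟩)
      ((measure_mono hsub).trans (measure_union_le _ _))
  have hslope : ENNReal.ofReal (1 / h) < ENNReal.ofReal (1 / h') :=
    (ENNReal.ofReal_lt_ofReal_iff (one_div_pos.2 hpos)).2 (one_div_lt_one_div_of_lt hpos hlt)
  refine ObstacleFlow.volume_eq_zero_of_distMeasure_eq_zero hE.frontier_null
    (hF.admissible.measurable.diff hF'.admissible.measurable) ?_
  by_contra hzero
  exact hle.not_gt (ENNReal.mul_lt_mul_left hzero hne hslope)

theorem mainTheorem10 {n : ℕ} (Ω E : Set (EuclideanSpace ℝ (Fin n)))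
    (hE : ObstacleFlow.IsMinimizingHull E) (hper : ObstacleFlow.perimeter E < ⊤)
    (hΩ : Ω ⊆ E) (h h' : ℝ) (hpos : 0 < h') (hlt : h' < h)
    (F F' : Set (EuclideanSpace ℝ (Fin n)))
    (hF : ObstacleFlow.IsStep h Ω E F) (hF' : ObstacleFlow.IsStep h' Ω E F') :
    volume (F \ F') = 0 :=
  mainTheorem10_general hE hper hΩ hpos hlt hF.minimizer hF'.minimizer
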